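/- All graphs are finite, undirected, nonempty, without loops or multiple edges. For a graph $X$, $\mathcal E(X)$ is its edge set; a 3-edge-decomposition of $X$ is a partition of $\mathcal E(X)$ into exactly three (nonempty) classes such that no two distinct edges with a common endpoint are in the same class, $ED(X)$ is the set of all of them, and for a given $\delta\in ED(X)$ we write $d\sim d'$ if $d$ and $d'$ are in the same class of $\delta$. A pentagon is a 5-cycle, regarded as a subgraph. For a set $S$ of edges of $X$, $X-S$ is $X$ with the edges in $S$ (but no vertices) deleted. A snark is a connected cubic graph $G$ such that (i) the girth of $G$ is at least 5; (ii) $G$ is cyclically 4-edge-connected: for any two vertex-disjoint cycles $C_1,C_2$ of $G$ and any set $S$ of at most 3 edges of $G$, none of them an edge of $C_1$ or $C_2$, there is a path in $G-S$ from $C_1$ to $C_2$; (iii) the edges of $G$ cannot be coloured with three colours so that edges with a common endpoint have different colours. For an edge $e=(u,w)$ of a snark $G$, let $G_e$ be the cubic graph obtained from $G$ by deleting $u$ and $w$ (with all edges at them), and then inserting an edge between the two neighbours of $u$ other than $w$, and an edge between the two neighbours of $w$ other than $u$. Put $\psi(G,e):=\tfrac13\,\mathrm{card}\,ED(G_e)$.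 **Theorem 4.5.** Let $G$ be a snark. (A) If $H$ is a subgraph of $G$ that is connected and is a union of pentagons of $G$ (for instance a single pentagon), then the numbers $\psi(G,e)$, $e\in\mathcal E(H)$, are all equal. (B) Let $P$ be a pentagon in $G$ with (distinct) vertices $v_i$ and edges $(v_i,v_{i+1})$, $i\in\mathbf Z_5$. For each $i\in\mathbf Z_5$ there is exactly one edge of $G-\mathcal E(P)$ with endpoint $v_i$; call it $\epsilon_i$. Then for every edge $e$ of $P$: (i) $\mathrm{card}\,ED(G-\mathcal E(P))=5\,\psi(G,e)$; (ii) for each $i\in\mathbf Z_5$, $\mathrm{card}\,\{\delta\in ED(G-\mathcal E(P)):\ \epsilon_{i-2}\sim\epsilon_i\sim\epsilon_{i+2}\}=\psi(G,e)$. -/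

import Mathlib

namespace SnarkPentagon

variable {V : Type*}

/-- Equivalence relations on the edge set, i.e. partitions of the edge set, with exactly three
classes, such that two distinct edges with a common endpoint are never in the same class.
For `δ ∈ ED G`, the relation `δ e₁ e₂` says that `e₁` and `e₂` belong to the same class. -/
def ED (G : SimpleGraph V) : Set (Setoid G.edgeSet) :=
  {δ | δ.classes.ncard = 3 ∧ ∀ e₁ e₂ : G.edgeSet, G.lineGraph.Adj e₁ e₂ → ¬ δ e₁ e₂}

/-- The edges of `G` can be coloured with three colours, adjacent edges getting different ones. -/
def IsEdgeThreeColorable (G : SimpleGraph V) : Prop :=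
  G.lineGraph.Colorable 3

/-- For any two vertex-disjoint cycles and any set `S` of at most `n - 1` edges, none of which lies
on the two cycles, some path of `G - S` joins the two cycles. -/
def IsCyclicallyEdgeConnected (n : ℕ) (G : SimpleGraph V) : Prop :=
  ∀ (a b : V) (C₁ : G.Walk a a) (C₂ : G.Walk b b), C₁.IsCycle → C₂.IsCycle →
    (∀ x, x ∈ C₁.support → x ∉ C₂.support) →
    ∀ S : Finset (Sym2 V), (S : Set (Sym2 V)) ⊆ G.edgeSet → S.card ≤ n - 1 →
      (∀ e ∈ S, e ∉ C₁.edges ∧ e ∉ C₂.edges) →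
      ∃ x ∈ C₁.support, ∃ y ∈ C₂.support, (G.deleteEdges (S : Set (Sym2 V))).Reachable x y

/-- A snark: a connected cubic graph of girth at least five that is cyclically
4-edge-connected and not edge-3-colourable. -/
structure IsSnark (G : SimpleGraph V) [G.LocallyFinite] : Prop where
  connected : G.Connected
  cubic : G.IsRegularOfDegree 3
  girth : 5 ≤ G.egirth
  cyclically_connected : IsCyclicallyEdgeConnected 4 G
  not_colorable : ¬ IsEdgeThreeColorable G

/-- The graph `G_e`: delete the two endpoints of `e`, and for each endpoint `p` of `e` join the
remaining neighbours of `p` by a new edge. -/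
def edgeReduction (G : SimpleGraph V) (e : Sym2 V) : SimpleGraph {x : V // x ∉ e} where
  Adj x y := x ≠ y ∧ (G.Adj x y ∨ ∃ p ∈ e, G.Adj p x ∧ G.Adj p y)
  symm := ⟨fun _ _ h => ⟨h.1.symm, h.2.imp (fun k => k.symm)
    (fun ⟨p, hp, k₁, k₂⟩ => ⟨p, hp, k₂, k₁⟩)⟩⟩
  loopless := ⟨fun _ h => h.1 rfl⟩

/-- The Kászonyi number: one third of the number of 3-edge-decompositions of `G_e`. -/
noncomputable def psi (G : SimpleGraph V) (e : Sym2 V) : ℚ :=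
  (1 / 3 : ℚ) * ((ED (edgeReduction G e)).ncard : ℚ)

/-- The subgraph `P` is a 5-cycle with vertices `v 0, …, v 4` in cyclic order. -/
structure IsPentagonWith {G : SimpleGraph V} (P : G.Subgraph) (v : ZMod 5 → V) : Prop where
  injective : Function.Injective v
  verts_eq : P.verts = Set.range v
  edgeSet_eq : P.edgeSet = Set.range fun i : ZMod 5 => s(v i, v (i + 1))

/-- The subgraph `P` is a pentagon, i.e. a 5-cycle. -/
def IsPentagon {G : SimpleGraph V} (P : G.Subgraph) : Prop :=
  ∃ v : ZMod 5 → V, IsPentagonWith P v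

end SnarkPentagon

namespace SnarkPentagon

/-! Count proper colourings by `ZMod 3` instead of partitions; when all three colours must occur,
each partition is counted six times. In `ZMod 3` three distinct colours sum to zero, so the third
colour beside `a ≠ b` is `-a-b`.

Let `X` be `G` without the edges of a pentagon. A colouring of `X` uses every colour an odd number
of times on the five edges leaving the pentagon (`odd_card`), so the multiplicities are 3, 1, 1.
Three equal colours at consecutive vertices would extend to the pentagon and colour `G`. Hence the
majority colour sits at `i-2, i, i+2` for a unique `i`. A Kempe swap starting at `i-1` moves this
centre to `i+2`; it is injective and 2 generates `ZMod 5`, so all five types have the same number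
`N` of colourings. Therefore `6 * |ED X| = 5 * N`, and each type gives `N / 6` partitions.

For `e = (v 0, v 1)`, a colouring of `G_e` is a colouring of `X` of type 0, 1 or 3, with the colours
of the two surviving pentagon edges forced. So `6 * |ED G_e| = 3 * N`, that is `6 * ψ = N`, which
proves (B) and makes `ψ` constant on a pentagon. For (A), two pentagons meeting at a vertex of a
cubic graph share an edge there, so constancy propagates along walks. -/

/-! ### Labelling the classes of a partition -/

/-- A set of partitions into three classes, each labelled by colours in all possible ways. -/
theorem ncard_colorings_eq {α : Type*} (S : Set (Setoid α))
    (hS : ∀ δ ∈ S, δ.classes.ncard = 3) :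
    {c : α → ZMod 3 | Function.Surjective c ∧ Setoid.ker c ∈ S}.ncard = 6 * S.ncard := by
  have hq : ∀ δ : S, Nonempty (Quotient δ.1 ≃ ZMod 3) := fun δ => by
    have h3 : Nat.card (Quotient δ.1) = 3 := by
      rw [Nat.card_congr (Setoid.quotientEquivClasses δ.1), Nat.card_coe_set_eq]
      exact hS δ.1 δ.2
    have : Finite (Quotient δ.1) := Nat.finite_of_card_ne_zero (by omega)
    have := Fintype.ofFinite (Quotient δ.1)
    exact ⟨Fintype.equivOfCardEq (by rw [← Nat.card_eq_fintype_card, h3, ZMod.card])⟩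
  have q := fun δ => (hq δ).some
  have hker : ∀ (δ : S) (σ : Equiv.Perm (ZMod 3)),
      Setoid.ker (fun a => σ (q δ (Quotient.mk δ.1 a))) = δ.1 := fun δ σ => by
    ext a b
    simp only [Setoid.ker_def, EmbeddingLike.apply_eq_iff_eq]
    exact Quotient.eq
  -- With a reference labelling `q δ` chosen for each partition, the labellings of `δ` are a torsor
  -- under the six permutations of the colours.
  let F : S × Equiv.Perm (ZMod 3) →
      {c : α → ZMod 3 | Function.Surjective c ∧ Setoid.ker c ∈ S} := fun p =>
    ⟨fun a => p.2 (q p.1 (Quotient.mk p.1.1 a)),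
      (p.2.surjective.comp (q p.1).surjective).comp Quotient.mk_surjective, by
        rw [hker]; exact p.1.2⟩
  have hF : Function.Bijective F := by
    constructor
    · rintro ⟨δ, σ⟩ ⟨δ', σ'⟩ h
      have h' := congrArg Subtype.val h
      have hδ : δ = δ' := Subtype.ext <| by
        rw [← hker δ σ, ← hker δ' σ']; exact congrArg Setoid.ker h'
      subst hδ
      refine Prod.ext rfl (Equiv.ext fun k => ?_)
      obtain ⟨a, ha⟩ := ((q δ).surjective.comp (Quotient.mk_surjective (s := δ.1))) k
      have := congrFun h' a
      simp only [F] at this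
      simp only [Function.comp] at ha
      rwa [ha] at this
    · rintro ⟨c, hc, hk⟩
      refine ⟨⟨⟨Setoid.ker c, hk⟩,
        (q ⟨Setoid.ker c, hk⟩).symm.trans (Setoid.quotientKerEquivOfSurjective c hc)⟩, ?_⟩
      apply Subtype.ext
      funext a
      simp only [F, Equiv.trans_apply, Equiv.symm_apply_apply]
      rfl
  have := Nat.card_congr (Equiv.ofBijective F hF)
  rw [Nat.card_coe_set_eq, Nat.card_prod, Nat.card_coe_set_eq] at this
  rw [← this, mul_comm]
  congr 1
  simp [Nat.card_eq_fintype_card, Fintype.card_perm, Nat.factorial]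

/-! ### Colour patterns on the edges leaving a pentagon -/

/-- The colours of the edges of a pentagon, the `i`-th one joining the vertices `i` and `i + 1`, which
are forced by the colours `x` of the five edges leaving it and the colour `k` of the edge `0`. -/
def pentagonColors (x : ZMod 5 → ZMod 3) (k : ZMod 3) : ZMod 5 → ZMod 3 :=
  let k₁ := - x 1 - k
  let k₂ := - x 2 - k₁
  let k₃ := - x 3 - k₂
  ![k, k₁, k₂, k₃, - x 4 - k₃]

/-- The colours of the five edges leaving a pentagon satisfy the parity condition and do not extend
to the pentagon. -/
def IsObstruction (x : ZMod 5 → ZMod 3) : Prop :=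
  (∀ k, Odd (Finset.univ.filter fun i => x i = k).card) ∧
    ¬ ∃ k, ∀ i, pentagonColors x k (i - 1) ≠ pentagonColors x k i ∧
      pentagonColors x k (i - 1) ≠ x i ∧ pentagonColors x k i ≠ x i

/-- The edges leaving the pentagon at `i` and at the two vertices opposite to `i` have the same
colour. -/
def IsTriple (i : ZMod 5) (x : ZMod 5 → ZMod 3) : Prop :=
  x (i - 2) = x i ∧ x i = x (i + 2)

instance (i : ZMod 5) (x : ZMod 5 → ZMod 3) : Decidable (IsTriple i x) :=
  inferInstanceAs (Decidable (_ ∧ _))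

instance : DecidablePred IsObstruction := fun _ => inferInstanceAs (Decidable (_ ∧ _))

/-- The multiplicities are 3, 1, 1, and a majority colour at three consecutive vertices extends:
alternate the two minority colours along the four pentagon edges at these vertices, and use the
majority colour on the fifth. Only the non-consecutive triples remain. -/
theorem IsObstruction.existsUnique_isTriple :
    ∀ x, IsObstruction x → ∃ i, IsTriple i x ∧ ∀ j, IsTriple j x → j = i := by
  decide +kernel

/-- The right-hand side is the condition for extending to the reduction at `(v 0, v 1)`. Types 2 and
4 fail because there `x 0 = x 4`, respectively `x 1 = x 2`. -/
theorem IsObstruction.isTriple_zero_or_one_or_three_iff :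
    ∀ x, IsObstruction x → ((IsTriple 0 x ∨ IsTriple 1 x ∨ IsTriple 3 x) ↔
      (x 1 ≠ x 2 ∧ x 0 ≠ x 4 ∧ - x 1 - x 2 ≠ x 3 ∧ - x 0 - x 4 ≠ x 3 ∧
        - x 1 - x 2 ≠ - x 0 - x 4)) := by
  decide +kernel

/-- Exchanging the two colours other than that of the edge at `i + 1`, on a set of at most two of
the five edges which contains the edge at `i - 1`. -/
theorem IsObstruction.isTriple_add_two :
    ∀ x, IsObstruction x → ∀ i, IsTriple i x → ∀ J : Finset (ZMod 5), J.card ≤ 2 → i - 1 ∈ J →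
      IsObstruction (fun j => if j ∈ J then - x (i + 1) - x j else x j) →
      IsTriple (i + 2) (fun j => if j ∈ J then - x (i + 1) - x j else x j) := by
  -- The only surviving case is `J = {i - 1, i - 2}`. Swapping `i - 1` alone or with `i + 1` breaks
  -- parity; swapping it with `i` or `i + 2` makes the majority consecutive, hence extendable.
  decide +kernel

theorem IsObstruction.surjective {x : ZMod 5 → ZMod 3} (h : IsObstruction x) :
    Function.Surjective x := fun k => by
  obtain ⟨i, hi⟩ := Finset.card_pos.1 (h.1 k).pos
  exact ⟨i, (Finset.mem_filter.1 hi).2⟩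

/-! ### Proper colourings versus partitions -/

/-- The proper edge colourings of `G` with colours in `ZMod 3`. -/
def edgeColorings {V : Type*} (G : SimpleGraph V) : Set (G.edgeSet → ZMod 3) :=
  {c | ∀ (d d' : G.edgeSet) (z : V), z ∈ d.1 → z ∈ d'.1 → c d = c d' → d = d'}

theorem mem_edgeColorings_iff_ker {V : Type*} {G : SimpleGraph V} {c : G.edgeSet → ZMod 3}
    (hc : Function.Surjective c) : c ∈ edgeColorings G ↔ Setoid.ker c ∈ ED G := by
  have h3 : (Setoid.ker c).classes.ncard = 3 := by
    rw [← Nat.card_coe_set_eq, ← Nat.card_congr (Setoid.quotientEquivClasses _),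
      Nat.card_congr (Setoid.quotientKerEquivOfSurjective c hc), Nat.card_zmod]
  constructor
  · refine fun h => ⟨h3, fun d d' hd hk => ?_⟩
    obtain ⟨hne, z, hz, hz'⟩ := SimpleGraph.lineGraph_adj_iff_exists.1 hd
    exact hne (h d d' z hz hz' hk)
  · intro h d d' z hz hz' hk
    by_contra hne
    exact h.2 d d' (SimpleGraph.lineGraph_adj_iff_exists.2 ⟨hne, z, hz, hz'⟩) hk

/-- If all proper edge colourings of `G` use the three colours, the partitions with a given property
are counted by the colourings with this property. -/
theorem ncard_edgeColorings_eq {V : Type*} {G : SimpleGraph V}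
    (hs : ∀ c ∈ edgeColorings G, Function.Surjective c) (p : Setoid G.edgeSet → Prop) :
    {c ∈ edgeColorings G | p (Setoid.ker c)}.ncard = 6 * {δ ∈ ED G | p δ}.ncard := by
  rw [← ncard_colorings_eq {δ ∈ ED G | p δ} fun δ hδ => hδ.1.1]
  congr 1
  ext c
  constructor
  · exact fun h => ⟨hs c h.1, (mem_edgeColorings_iff_ker (hs c h.1)).1 h.1, h.2⟩
  · exact fun h => ⟨(mem_edgeColorings_iff_ker h.1).2 h.2.1, h.2.2⟩

/-! ### Subgraphs spanned by colour classes -/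

section ColorGraph

variable {V : Type*} {X : SimpleGraph V}

/-- The subgraph formed by the edges whose colours are in `s`. -/
def colorGraph (c : X.edgeSet → ZMod 3) (s : Set (ZMod 3)) : SimpleGraph V where
  Adj x y := ∃ h : X.Adj x y, c ⟨s(x, y), h⟩ ∈ s
  symm := ⟨fun x y ⟨h, hs⟩ => ⟨h.symm, by simpa only [Sym2.eq_swap] using hs⟩⟩
  loopless := ⟨fun x h => X.loopless.irrefl x h.1⟩

theorem edgeColorings.eq_of_adj {c : X.edgeSet → ZMod 3} (hc : c ∈ edgeColorings X) {x y z : V}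
    (hy : X.Adj x y) (hz : X.Adj x z) (h : c ⟨s(x, y), hy⟩ = c ⟨s(x, z), hz⟩) : y = z := by
  have := hc _ _ x (Sym2.mem_mk_left x y) (Sym2.mem_mk_left x z) h
  exact Sym2.congr_right.1 (congrArg Subtype.val this)

theorem ncard_neighborSet_colorGraph_le {c : X.edgeSet → ZMod 3} (hc : c ∈ edgeColorings X)
    (s : Set (ZMod 3)) (x : V) : ((colorGraph c s).neighborSet x).ncard ≤ s.ncard := by
  classical
  refine Set.ncard_le_ncard_of_injOn (fun y => if h : X.Adj x y then c ⟨s(x, y), h⟩ else 0)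
    ?_ ?_ s.toFinite
  · rintro y ⟨h, hs⟩
    simpa only [dif_pos h] using hs
  · rintro y ⟨h, -⟩ z ⟨h', -⟩ hyz
    simp only [dif_pos h, dif_pos h'] at hyz
    exact edgeColorings.eq_of_adj hc h h' hyz

theorem exists_colorGraph_adj {c : X.edgeSet → ZMod 3} (hc : c ∈ edgeColorings X) {x : V}
    (hx : (X.neighborSet x).ncard = 3) (k : ZMod 3) : ∃ y, (colorGraph c {k}).Adj x y := by
  have : Finite (X.neighborSet x) := Nat.finite_of_card_ne_zero (by
    rw [Nat.card_coe_set_eq]; omega)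
  have := Fintype.ofFinite (X.neighborSet x)
  have hb : Function.Bijective fun y : X.neighborSet x => c ⟨s(x, y.1), y.2⟩ := by
    rw [Fintype.bijective_iff_injective_and_card]
    refine ⟨fun y z h => Subtype.ext (edgeColorings.eq_of_adj hc y.2 z.2 h), ?_⟩
    rw [← Nat.card_eq_fintype_card, Nat.card_coe_set_eq, hx, ZMod.card]
  obtain ⟨y, hy⟩ := hb.2 k
  exact ⟨y.1, y.2, hy⟩

/-- A connected component of a graph of maximal degree two contains at most two vertices of degree
at most one. -/
theorem card_degree_le_one_le_two [Fintype V] (H : SimpleGraph V)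
    (h2 : ∀ x, (H.neighborSet x).ncard ≤ 2) (C : H.ConnectedComponent) (T : Finset V)
    (hT : ∀ x ∈ T, x ∈ C.supp ∧ (H.neighborSet x).ncard ≤ 1) : T.card ≤ 2 := by
  classical
  have hconn := C.connected_toSimpleGraph
  have h1 := hconn.card_vert_le_card_edgeSet_add_one
  have hsum := C.toSimpleGraph.sum_degrees_eq_twice_card_edges
  have hdeg : ∀ x : C, C.toSimpleGraph.degree x ≤ (H.neighborSet x.1).ncard := fun x => by
    rw [← SimpleGraph.card_neighborSet_eq_degree, ← Nat.card_eq_fintype_card, Nat.card_coe_set_eq]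
    refine Set.ncard_le_ncard_of_injOn (fun y => y.1) ?_ Subtype.val_injective.injOn
    intro y hy
    exact hy
  have hT' : (Finset.univ.filter fun x : C => x.1 ∈ T).card = T.card := by
    rw [← Finset.card_image_of_injective _ Subtype.val_injective]
    congr 1
    ext x
    simp only [Finset.mem_image, Finset.mem_filter, Finset.mem_univ, true_and, Subtype.exists,
      exists_and_left, exists_prop, exists_eq_right_right, and_iff_left_iff_imp]
    exact fun hx => (hT x hx).1
  -- Each vertex of `T` has a deficit of at least one, so twice the number of edges plus `T.card` is
  -- at most twice the number of vertices; connectedness bounds the number of edges from below.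
  have hle : ∑ x : C, (C.toSimpleGraph.degree x + if x.1 ∈ T then 1 else 0) ≤
      ∑ _x : C, 2 := Finset.sum_le_sum fun x _ => by
    split_ifs with hx
    · have := (hdeg x).trans (hT x hx).2
      omega
    · exact (hdeg x).trans (h2 x)
  rw [Finset.sum_add_distrib, hsum, ← Finset.card_filter, hT', Finset.sum_const, Finset.card_univ,
    ← Nat.card_eq_fintype_card, smul_eq_mul] at hle
  rw [Nat.card_eq_fintype_card (α := C.toSimpleGraph.edgeSet),
    ← SimpleGraph.edgeFinset_card] at h1
  omega

end ColorGraph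

/-! ### The graph without the pentagon edges: parity -/

/-- `X` is a cubic graph on an even number of vertices from which the edges of a pentagon with
vertices `v i` have been removed; `ε i` is the remaining edge at `v i`. -/
structure IsPentagonComplement {V : Type*} (X : SimpleGraph V) (v : ZMod 5 → V)
    (ε : ZMod 5 → X.edgeSet) : Prop where
  mem_iff : ∀ i d, v i ∈ d.1 ↔ d = ε i
  eq_of_mem : ∀ i j, v j ∈ (ε i).1 → j = i
  degree : ∀ y, y ∉ Set.range v → (X.neighborSet y).ncard = 3
  even_card : Even (Nat.card V)

namespace IsPentagonComplement

variable {V : Type*} {X : SimpleGraph V} {v : ZMod 5 → V} {ε : ZMod 5 → X.edgeSet}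

theorem injective (h : IsPentagonComplement X v ε) : Function.Injective v := fun i j hij =>
  h.eq_of_mem j i (hij ▸ (h.mem_iff j _).2 rfl)

theorem ncard_neighborSet_le_one [Finite V] (h : IsPentagonComplement X v ε) (c : X.edgeSet → ZMod 3)
    (s : Set (ZMod 3)) (i : ZMod 5) : ((colorGraph c s).neighborSet (v i)).ncard ≤ 1 := by
  refine (Set.ncard_le_one).2 ?_
  rintro y ⟨hy, -⟩ z ⟨hz, -⟩
  have h1 := (h.mem_iff i ⟨s(v i, y), hy⟩).1 (Sym2.mem_mk_left _ _)
  have h2 := (h.mem_iff i ⟨s(v i, z), hz⟩).1 (Sym2.mem_mk_left _ _)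
  exact Sym2.congr_right.1 (congrArg Subtype.val (h1.trans h2.symm))

/-- A colour class is a matching, so it covers an even number of vertices. It misses exactly the `v
i` whose edge has another colour; their number is even because `V` has even order, and five minus an
even number is odd. -/
theorem odd_card [Fintype V] (h : IsPentagonComplement X v ε) {c : X.edgeSet → ZMod 3}
    (hc : c ∈ edgeColorings X) (k : ZMod 3) :
    Odd (Finset.univ.filter fun i => c (ε i) = k).card := by
  classical
  have hadj : ∀ i, (∃ y, (colorGraph c {k}).Adj (v i) y) ↔ c (ε i) = k := fun i => by
    constructor
    · rintro ⟨y, hy, hk⟩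
      rw [← (h.mem_iff i ⟨s(v i, y), hy⟩).1 (Sym2.mem_mk_left _ _)]
      exact hk
    · rintro hk
      obtain ⟨y, hy⟩ := (Sym2.mem_iff_exists).1 ((h.mem_iff i (ε i)).2 rfl)
      have hX : s(v i, y) ∈ X.edgeSet := hy ▸ (ε i).2
      have hd : ε i = ⟨s(v i, y), hX⟩ := Subtype.ext hy
      exact ⟨y, hX, hd ▸ hk⟩
  have hle : ∀ x, (colorGraph c {k}).degree x ≤ 1 := fun x => by
    have := ncard_neighborSet_colorGraph_le hc {k} x
    rwa [Set.ncard_singleton, ← Nat.card_coe_set_eq, Nat.card_eq_fintype_card,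
      SimpleGraph.card_neighborSet_eq_degree] at this
  have hpos : ∀ x, Odd ((colorGraph c {k}).degree x) ↔ ∃ y, (colorGraph c {k}).Adj x y := fun x => by
    rw [← SimpleGraph.degree_pos_iff_exists_adj]
    have := hle x
    constructor
    · exact fun ho => ho.pos
    · intro hp
      rw [show (colorGraph c {k}).degree x = 1 by omega]
      exact odd_one
  have he := (colorGraph c {k}).even_card_odd_degree_vertices
  have hcompl : (Finset.univ.filter fun x => ¬ Odd ((colorGraph c {k}).degree x)) =
      (Finset.univ.filter fun i => ¬ c (ε i) = k).image v := by
    ext x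
    simp only [Finset.mem_filter, Finset.mem_univ, true_and, Finset.mem_image, hpos]
    constructor
    · intro hx
      by_cases hv : x ∈ Set.range v
      · obtain ⟨i, rfl⟩ := hv
        exact ⟨i, fun hk => hx ((hadj i).2 hk), rfl⟩
      · exact absurd (exists_colorGraph_adj hc (h.degree x hv) k) hx
    · rintro ⟨i, hi, rfl⟩ hx
      exact hi ((hadj i).1 hx)
  have h1 := Finset.card_filter_add_card_filter_not (s := Finset.univ)
    fun x => Odd ((colorGraph c {k}).degree x)
  rw [hcompl, Finset.card_image_of_injective _ h.injective, Finset.card_univ,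
    ← Nat.card_eq_fintype_card] at h1
  have h2 := Finset.card_filter_add_card_filter_not (s := Finset.univ) fun i => c (ε i) = k
  rw [Finset.card_univ, ZMod.card] at h2
  have h3 := h.even_card
  rw [← h1] at h3
  have h4 := (Nat.even_add.1 h3).1 he
  rw [Nat.odd_iff]
  rw [Nat.even_iff] at h4
  omega

end IsPentagonComplement

/-! ### Kempe swaps -/

section Kempe

variable {V : Type*} {X : SimpleGraph V}

open Classical in
/-- Exchange the two colours other than `t` on the component of `z` in the subgraph formed by the
edges with these colours. -/
noncomputable def kempeSwap (t : ZMod 3) (z : V) (c : X.edgeSet → ZMod 3) : X.edgeSet → ZMod 3 :=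
  fun d => if ∃ y ∈ d.1, (colorGraph c {t}ᶜ).Reachable z y then - t - c d else c d

theorem neg_sub_eq_self_iff (t : ZMod 3) (k : ZMod 3) : - t - k = t ↔ k = t := by
  revert t k; decide

theorem neg_sub_self_eq (t : ZMod 3) : - t - t = t := by
  revert t; decide

open Classical in
-- Any endpoint of `d` can serve as the test: an edge of another colour than `t` lies in one
-- component, and colour `t` is fixed anyway, since `-t - t = t` in characteristic three.
theorem kempeSwap_apply {t : ZMod 3} {z : V} {c : X.edgeSet → ZMod 3} {d : X.edgeSet} {x : V}
    (hx : x ∈ d.1) :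
    kempeSwap t z c d = if (colorGraph c {t}ᶜ).Reachable z x then - t - c d else c d := by
  by_cases ht : c d = t
  · simp only [kempeSwap, ht, neg_sub_self_eq, ite_self]
  · unfold kempeSwap
    congr 1
    refine propext ⟨?_, fun h => ⟨x, hx, h⟩⟩
    rintro ⟨y, hy, hr⟩
    by_cases hxy : x = y
    · exact hxy ▸ hr
    · have hd : d.1 = s(y, x) := (Sym2.mem_and_mem_iff (Ne.symm hxy)).1 ⟨hy, hx⟩
      have hX : s(y, x) ∈ X.edgeSet := hd ▸ d.2
      have hd' : d = ⟨s(y, x), hX⟩ := Subtype.ext hd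
      exact hr.trans (SimpleGraph.Adj.reachable ⟨hX, fun h => ht (hd' ▸ h)⟩)

theorem kempeSwap_eq_iff (t : ZMod 3) (z : V) (c : X.edgeSet → ZMod 3) (d : X.edgeSet) :
    kempeSwap t z c d = t ↔ c d = t := by
  unfold kempeSwap
  split_ifs
  · exact neg_sub_eq_self_iff t _
  · rfl

theorem colorGraph_kempeSwap (t : ZMod 3) (z : V) (c : X.edgeSet → ZMod 3) :
    colorGraph (kempeSwap t z c) {t}ᶜ = colorGraph c {t}ᶜ := by
  ext x y
  simp only [colorGraph, Set.mem_compl_iff, Set.mem_singleton_iff, kempeSwap_eq_iff]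

theorem kempeSwap_kempeSwap (t : ZMod 3) (z : V) (c : X.edgeSet → ZMod 3) :
    kempeSwap t z (kempeSwap t z c) = c := by
  funext d
  rw [kempeSwap, colorGraph_kempeSwap]
  unfold kempeSwap
  split_ifs
  · ring
  · rfl

theorem kempeSwap_mem {t : ZMod 3} {z : V} {c : X.edgeSet → ZMod 3} (hc : c ∈ edgeColorings X) :
    kempeSwap t z c ∈ edgeColorings X := by
  intro d d' x hx hx' h
  rw [kempeSwap_apply hx, kempeSwap_apply hx'] at h
  refine hc d d' x hx hx' ?_
  split_ifs at h
  · exact sub_right_injective h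
  · exact h

end Kempe

/-! ### The five types of colourings are equally frequent -/

namespace IsPentagonComplement

variable {V : Type*} {X : SimpleGraph V} {v : ZMod 5 → V} {ε : ZMod 5 → X.edgeSet}

/-- The proper colourings giving the same colour to the edges leaving the pentagon at `v i` and at
the two opposite vertices. -/
def tripleColorings (ε : ZMod 5 → X.edgeSet) (i : ZMod 5) : Set (X.edgeSet → ZMod 3) :=
  {c ∈ edgeColorings X | IsTriple i fun j => c (ε j)}

theorem isTriple_kempeSwap [Fintype V] (h : IsPentagonComplement X v ε)
    (hX : ∀ c ∈ edgeColorings X, IsObstruction fun j => c (ε j)) {c : X.edgeSet → ZMod 3}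
    (hc : c ∈ edgeColorings X) {i : ZMod 5} (hi : IsTriple i fun j => c (ε j)) :
    IsTriple (i + 2) fun j => kempeSwap (c (ε (i + 1))) (v (i - 1)) c (ε j) := by
  classical
  set t := c (ε (i + 1)) with ht
  let H := colorGraph c {t}ᶜ
  let J := Finset.univ.filter fun j => H.Reachable (v (i - 1)) (v j)
  have heq : (fun j => kempeSwap t (v (i - 1)) c (ε j)) =
      fun j => if j ∈ J then - c (ε (i + 1)) - c (ε j) else c (ε j) := by
    funext j
    rw [kempeSwap_apply ((h.mem_iff j _).2 rfl), ← ht]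
    simp only [J, H, Finset.mem_filter, Finset.mem_univ, true_and]
    congr
  -- The Kempe component has maximal degree two, and pentagon vertices have degree at most one in
  -- it, so it reaches at most two of them.
  have hJ : J.card ≤ 2 := by
    rw [← Finset.card_image_of_injective J h.injective]
    refine card_degree_le_one_le_two H (fun x => ?_) (H.connectedComponentMk (v (i - 1))) _ ?_
    · refine (ncard_neighborSet_colorGraph_le hc {t}ᶜ x).trans ?_
      rw [Set.ncard_compl, Set.ncard_singleton, Nat.card_zmod]
    · intro x hx
      obtain ⟨j, hj, rfl⟩ := Finset.mem_image.1 hx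
      refine ⟨?_, h.ncard_neighborSet_le_one c _ j⟩
      exact SimpleGraph.ConnectedComponent.sound (Finset.mem_filter.1 hj).2.symm
  have hmem : i - 1 ∈ J := Finset.mem_filter.2 ⟨Finset.mem_univ _, .rfl⟩
  have hobs := hX _ (kempeSwap_mem (t := t) (z := v (i - 1)) hc)
  rw [heq] at hobs ⊢
  exact (hX c hc).isTriple_add_two _ i hi J hJ hmem hobs

theorem ncard_tripleColorings_le [Fintype V] (h : IsPentagonComplement X v ε)
    (hX : ∀ c ∈ edgeColorings X, IsObstruction fun j => c (ε j)) (i : ZMod 5) :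
    (tripleColorings ε i).ncard ≤ (tripleColorings ε (i + 2)).ncard := by
  refine Set.ncard_le_ncard_of_injOn
    (fun c => kempeSwap (c (ε (i + 1))) (v (i - 1)) c) ?_ ?_ (Set.toFinite _)
  · exact fun c hc => ⟨kempeSwap_mem hc.1, h.isTriple_kempeSwap hX hc.1 hc.2⟩
  · intro c _ c' _ heq
    -- The fixed colour depends on `c`, but it can be read off from the image because the edge
    -- carrying it is unchanged. The swap is then an involution, hence injective.
    have ht : ∀ c : X.edgeSet → ZMod 3,
        kempeSwap (c (ε (i + 1))) (v (i - 1)) c (ε (i + 1)) = c (ε (i + 1)) := fun c =>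
      (kempeSwap_eq_iff _ _ _ _).2 rfl
    have htt : c (ε (i + 1)) = c' (ε (i + 1)) := by
      rw [← ht c, ← ht c']
      exact congrFun heq _
    have := congrArg (kempeSwap (c (ε (i + 1))) (v (i - 1))) heq
    simp only [← htt, kempeSwap_kempeSwap] at this
    exact this

/-- The inequalities close up along the cycle 0, 2, 4, 1, 3, 0. -/
theorem ncard_tripleColorings_eq [Fintype V] (h : IsPentagonComplement X v ε)
    (hX : ∀ c ∈ edgeColorings X, IsObstruction fun j => c (ε j)) (i : ZMod 5) :
    (tripleColorings ε i).ncard = (tripleColorings ε 0).ncard := by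
  have h0 := h.ncard_tripleColorings_le hX 0
  have h1 := h.ncard_tripleColorings_le hX 2
  have h2 := h.ncard_tripleColorings_le hX 4
  have h3 := h.ncard_tripleColorings_le hX 1
  have h4 := h.ncard_tripleColorings_le hX 3
  rw [show (0 + 2 : ZMod 5) = 2 from rfl] at h0
  rw [show (2 + 2 : ZMod 5) = 4 from rfl] at h1
  rw [show (4 + 2 : ZMod 5) = 1 from rfl] at h2
  rw [show (1 + 2 : ZMod 5) = 3 from rfl] at h3
  rw [show (3 + 2 : ZMod 5) = 0 from rfl] at h4
  have : ∀ i : ZMod 5, i = 0 ∨ i = 1 ∨ i = 2 ∨ i = 3 ∨ i = 4 := by decide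
  rcases this i with rfl | rfl | rfl | rfl | rfl <;> omega

/-- Every proper colouring lies in exactly one of the five sets `tripleColorings ε i`. -/
theorem ncard_exists_isTriple [Fintype V] (h : IsPentagonComplement X v ε)
    (hX : ∀ c ∈ edgeColorings X, IsObstruction fun j => c (ε j)) (s : Finset (ZMod 5)) :
    {c ∈ edgeColorings X | ∃ i ∈ s, IsTriple i fun j => c (ε j)}.ncard =
      s.card * (tripleColorings ε 0).ncard := by
  induction s using Finset.induction_on with
  | empty => simp
  | insert i s hi ih =>
    have hu : {c ∈ edgeColorings X | ∃ j ∈ insert i s, IsTriple j fun j => c (ε j)} =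
        tripleColorings ε i ∪ {c ∈ edgeColorings X | ∃ j ∈ s, IsTriple j fun j => c (ε j)} := by
      ext c
      simp only [Finset.exists_mem_insert, tripleColorings, Set.mem_ofPred_eq, Set.mem_union]
      tauto
    rw [hu, Set.ncard_union_eq ?_ (Set.toFinite _) (Set.toFinite _), ih,
      h.ncard_tripleColorings_eq hX i, Finset.card_insert_of_notMem hi]
    · ring
    · rw [Set.disjoint_left]
      rintro c ⟨hc, hci⟩ ⟨-, j, hj, hcj⟩
      obtain ⟨k, -, hk⟩ := (hX c hc).existsUnique_isTriple
      exact hi (((hk i hci).trans (hk j hcj).symm) ▸ hj)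

theorem ncard_edgeColorings_eq_five [Fintype V] (h : IsPentagonComplement X v ε)
    (hX : ∀ c ∈ edgeColorings X, IsObstruction fun j => c (ε j)) :
    (edgeColorings X).ncard = 5 * (tripleColorings ε 0).ncard := by
  refine Eq.trans ?_ (h.ncard_exists_isTriple hX Finset.univ)
  congr 1
  ext c
  refine ⟨fun hc => ⟨hc, ?_⟩, fun hc => hc.1⟩
  obtain ⟨k, hk, -⟩ := (hX c hc).existsUnique_isTriple
  exact ⟨k, Finset.mem_univ k, hk⟩

theorem ncard_isTriple_zero_or_one_or_three [Fintype V] (h : IsPentagonComplement X v ε)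
    (hX : ∀ c ∈ edgeColorings X, IsObstruction fun j => c (ε j)) :
    {c ∈ edgeColorings X | IsTriple 0 (fun j => c (ε j)) ∨ IsTriple 1 (fun j => c (ε j)) ∨
      IsTriple 3 (fun j => c (ε j))}.ncard = 3 * (tripleColorings ε 0).ncard := by
  refine Eq.trans ?_ (h.ncard_exists_isTriple hX {0, 1, 3})
  simp

end IsPentagonComplement

/-! ### Returning to `G`: non-extendable colourings -/

/-- The graph `X` arises from `G` by removing the edges of a pentagon with vertices `v i`, whose
other edges are the `ε i`. -/
structure IsPentagonRemoval {V : Type*} (G X : SimpleGraph V) (v : ZMod 5 → V)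
    (ε : ZMod 5 → X.edgeSet) : Prop extends IsPentagonComplement X v ε where
  adj_iff : ∀ x y, G.Adj x y ↔ X.Adj x y ∨ ∃ i, s(x, y) = s(v i, v (i + 1))
  notMem_of_mem : ∀ i w, w ∈ (ε i).1 → w ∉ (ε (i + 1)).1

namespace IsPentagonRemoval

variable {V : Type*} {G X : SimpleGraph V} {v : ZMod 5 → V} {ε : ZMod 5 → X.edgeSet}

theorem not_adj (h : IsPentagonRemoval G X v ε) (i j : ZMod 5) : ¬ X.Adj (v i) (v j) := fun hij => by
  have h1 := (h.mem_iff i ⟨s(v i, v j), hij⟩).1 (Sym2.mem_mk_left _ _)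
  have h2 := h.eq_of_mem i j (h1 ▸ Sym2.mem_mk_right _ _)
  exact hij.ne (h2 ▸ rfl)

theorem eq_of_adj (h : IsPentagonRemoval G X v ε) {i : ZMod 5} {x : V} (hx : X.Adj (v i) x) :
    ε i = ⟨s(v i, x), hx⟩ :=
  ((h.mem_iff i ⟨s(v i, x), hx⟩).1 (Sym2.mem_mk_left _ _)).symm

theorem mem_of_adj (h : IsPentagonRemoval G X v ε) {i : ZMod 5} {x : V} (hx : X.Adj (v i) x) :
    x ∈ (ε i).1 := by
  rw [h.eq_of_adj hx]; exact Sym2.mem_mk_right _ _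

theorem mem_self (h : IsPentagonRemoval G X v ε) (i : ZMod 5) : v i ∈ (ε i).1 :=
  (h.mem_iff i _).2 rfl

theorem edge_injective (h : IsPentagonRemoval G X v ε) : Function.Injective ε := fun i j hij =>
  h.eq_of_mem j i (hij ▸ h.mem_self i)

theorem adj_succ (h : IsPentagonRemoval G X v ε) (i : ZMod 5) : G.Adj (v i) (v (i + 1)) :=
  (h.adj_iff _ _).2 (Or.inr ⟨i, rfl⟩)

/-- A colouring of `X` which extends to the pentagon yields a colouring of `G`. -/
theorem isEdgeThreeColorable (h : IsPentagonRemoval G X v ε) {c : X.edgeSet → ZMod 3}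
    (hc : c ∈ edgeColorings X) (p : ZMod 5 → ZMod 3)
    (hp : ∀ i, p (i - 1) ≠ p i ∧ p (i - 1) ≠ c (ε i) ∧ p i ≠ c (ε i)) :
    IsEdgeThreeColorable G := by
  classical
  have hcase : ∀ d : G.edgeSet, d.1 ∉ X.edgeSet → ∃ i, d.1 = s(v i, v (i + 1)) := by
    rintro ⟨d, hd⟩ hX
    induction d using Sym2.ind with
    | _ x y => exact ((h.adj_iff x y).1 hd).resolve_left hX
  choose! idx hidx using hcase
  let C : G.edgeSet → ZMod 3 := fun d => if hd : d.1 ∈ X.edgeSet then c ⟨d.1, hd⟩ else p (idx d)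
  have hmix : ∀ (d d' : G.edgeSet) (z : V), z ∈ d.1 → z ∈ d'.1 → d.1 ∈ X.edgeSet →
      d'.1 ∉ X.edgeSet → C d ≠ C d' := by
    intro d d' z hz hz' hd hd' heq
    simp only [C, dif_pos hd, dif_neg hd'] at heq
    rw [hidx d' hd', Sym2.mem_iff] at hz'
    rcases hz' with rfl | rfl
    · rw [(h.mem_iff _ ⟨d.1, hd⟩).1 hz] at heq
      exact (hp _).2.2 heq.symm
    · rw [(h.mem_iff _ ⟨d.1, hd⟩).1 hz] at heq
      have := (hp (idx d' + 1)).2.1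
      rw [add_sub_cancel_right] at this
      exact this heq.symm
  have hC : ∀ d d' : G.edgeSet, G.lineGraph.Adj d d' → C d ≠ C d' := by
    intro d d' hdd
    obtain ⟨hne, z, hz, hz'⟩ := SimpleGraph.lineGraph_adj_iff_exists.1 hdd
    by_cases hd : d.1 ∈ X.edgeSet <;> by_cases hd' : d'.1 ∈ X.edgeSet
    · intro heq
      simp only [C, dif_pos hd, dif_pos hd'] at heq
      exact hne (Subtype.ext (congrArg Subtype.val (hc ⟨d.1, hd⟩ ⟨d'.1, hd'⟩ z hz hz' heq) :))
    · exact hmix d d' z hz hz' hd hd'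
    · exact (hmix d' d z hz' hz hd' hd).symm
    · have hi : idx d ≠ idx d' := fun hi =>
        hne (Subtype.ext ((hidx d hd).trans (hi ▸ (hidx d' hd').symm)))
      simp only [C, dif_neg hd, dif_neg hd']
      rw [hidx d hd, Sym2.mem_iff] at hz
      rw [hidx d' hd', Sym2.mem_iff] at hz'
      rcases hz with rfl | rfl <;> rcases hz' with hz' | hz' <;> have hz' := h.injective hz'
      · exact absurd hz' hi
      · rw [hz']
        have := (hp (idx d' + 1)).1
        rw [add_sub_cancel_right] at this
        exact this.symm
      · rw [← hz']
        have := (hp (idx d + 1)).1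
        rwa [add_sub_cancel_right] at this
      · exact absurd (add_right_cancel hz') hi
  exact (SimpleGraph.Coloring.mk C (fun {d d'} => hC d d')).colorable

theorem isObstruction [Fintype V] (h : IsPentagonRemoval G X v ε) (hG : ¬ IsEdgeThreeColorable G)
    {c : X.edgeSet → ZMod 3} (hc : c ∈ edgeColorings X) : IsObstruction fun i => c (ε i) :=
  ⟨fun k => h.odd_card hc k, fun ⟨_, hk⟩ => hG (h.isEdgeThreeColorable hc _ hk)⟩

/-! ### Colourings of the reduction at `(v 0, v 1)` -/

section Reduction

open Classical in
/-- Move the vertex `v 0` to `v 4` and `v 1` to `v 2`. -/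
noncomputable def collapse (v : ZMod 5 → V) (x : V) : V :=
  if x = v 0 then v 4 else if x = v 1 then v 2 else x

theorem collapse_eq_iff (h : IsPentagonRemoval G X v ε) {x y : V} :
    collapse v x = collapse v y ↔ x = y ∨ (x = v 0 ∧ y = v 4) ∨ (x = v 4 ∧ y = v 0) ∨
      (x = v 1 ∧ y = v 2) ∨ (x = v 2 ∧ y = v 1) := by
  have h04 : v 0 ≠ v 4 := h.injective.ne (by decide)
  have h01 : v 0 ≠ v 1 := h.injective.ne (by decide)
  have h02 : v 0 ≠ v 2 := h.injective.ne (by decide)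
  have h14 : v 1 ≠ v 4 := h.injective.ne (by decide)
  have h12 : v 1 ≠ v 2 := h.injective.ne (by decide)
  have h24 : v 2 ≠ v 4 := h.injective.ne (by decide)
  unfold collapse
  split_ifs <;> grind

theorem collapse_notMem (h : IsPentagonRemoval G X v ε) (x : V) :
    collapse v x ∉ s(v 0, v 1) := by
  have h04 : v 0 ≠ v 4 := h.injective.ne (by decide)
  have h02 : v 0 ≠ v 2 := h.injective.ne (by decide)
  have h14 : v 1 ≠ v 4 := h.injective.ne (by decide)
  have h12 : v 1 ≠ v 2 := h.injective.ne (by decide)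
  rw [Sym2.mem_iff]
  unfold collapse
  split_ifs <;> grind

theorem collapse_of_notMem {x : V} (hx : x ∉ s(v 0, v 1)) : collapse v x = x := by
  rw [Sym2.mem_iff, not_or] at hx
  rw [collapse, if_neg hx.1, if_neg hx.2]

theorem collapse_zero (v : ZMod 5 → V) : collapse v (v 0) = v 4 := if_pos rfl

theorem collapse_one (h : IsPentagonRemoval G X v ε) : collapse v (v 1) = v 2 := by
  rw [collapse, if_neg (h.injective.ne (by decide)), if_pos rfl]

theorem collapse_adj (h : IsPentagonRemoval G X v ε) {x y : V} (hxy : X.Adj x y) :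
    (edgeReduction G s(v 0, v 1)).Adj ⟨collapse v x, h.collapse_notMem x⟩
      ⟨collapse v y, h.collapse_notMem y⟩ := by
  have hG : ∀ {x y}, X.Adj x y → G.Adj x y := fun hxy => (h.adj_iff _ _).2 (Or.inl hxy)
  have key : ∀ i x y, X.Adj x y → x = v i → (y ∉ s(v 0, v 1)) := by
    rintro i x y hxy rfl hy
    rcases Sym2.mem_iff.1 hy with rfl | rfl <;> exact h.not_adj _ _ hxy
  have hne : collapse v x ≠ collapse v y := by
    rw [Ne, h.collapse_eq_iff]
    rintro (rfl | ⟨rfl, rfl⟩ | ⟨rfl, rfl⟩ | ⟨rfl, rfl⟩ | ⟨rfl, rfl⟩)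
    · exact hxy.ne rfl
    all_goals exact h.not_adj _ _ hxy
  have h4 : G.Adj (v 0) (v 4) := (h.adj_succ 4).symm
  have h2 : G.Adj (v 1) (v 2) := h.adj_succ 1
  have hmain : ∀ x y, X.Adj x y → x ∈ s(v 0, v 1) →
      ∃ p ∈ s(v 0, v 1), G.Adj p (collapse v x) ∧ G.Adj p (collapse v y) := by
    intro x y hxy hx
    rcases Sym2.mem_iff.1 hx with rfl | rfl
    · refine ⟨v 0, hx, ?_, ?_⟩
      · rwa [collapse_zero]
      · rw [collapse_of_notMem (key _ _ _ hxy rfl)]; exact hG hxy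
    · refine ⟨v 1, hx, ?_, ?_⟩
      · rwa [h.collapse_one]
      · rw [collapse_of_notMem (key _ _ _ hxy rfl)]; exact hG hxy
  refine ⟨fun he => hne (congrArg Subtype.val he), ?_⟩
  by_cases hx : x ∈ s(v 0, v 1)
  · exact Or.inr (hmain x y hxy hx)
  · by_cases hy : y ∈ s(v 0, v 1)
    · obtain ⟨p, hp, hp1, hp2⟩ := hmain y x hxy.symm hy
      exact Or.inr ⟨p, hp, hp2, hp1⟩
    · left
      simp only [collapse_of_notMem hx, collapse_of_notMem hy]
      exact hG hxy

/-- The edge of the reduction of `G` at `(v 0, v 1)` arising from an edge of `X`. -/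
noncomputable def edgeMap (h : IsPentagonRemoval G X v ε) (d : X.edgeSet) :
    (edgeReduction G s(v 0, v 1)).edgeSet :=
  ⟨d.1.map fun x => ⟨collapse v x, h.collapse_notMem x⟩, by
    obtain ⟨d, hd⟩ := d
    induction d using Sym2.ind with
    | _ x y => exact h.collapse_adj hd⟩

theorem mem_edgeMap_iff (h : IsPentagonRemoval G X v ε) {d : X.edgeSet}
    {z : {x : V // x ∉ s(v 0, v 1)}} : z ∈ (h.edgeMap d).1 ↔ ∃ x ∈ d.1, collapse v x = z := by
  simp only [edgeMap, Sym2.mem_map, Subtype.ext_iff]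

/-- Edges of `X` could merge only if `v 0` and `v 4`, or `v 1` and `v 2`, had a common neighbour,
which `notMem_of_mem` forbids. Both ends cannot be identified at once, as no edge of `X` joins two
pentagon vertices. -/
theorem edgeMap_injective (h : IsPentagonRemoval G X v ε) : Function.Injective h.edgeMap := by
  have h4 : ∀ w, X.Adj (v 4) w → ¬ X.Adj (v 0) w := fun w hw hw' =>
    h.notMem_of_mem 4 w (h.mem_of_adj hw) (h.mem_of_adj hw')
  have h1 : ∀ w, X.Adj (v 1) w → ¬ X.Adj (v 2) w := fun w hw hw' =>
    h.notMem_of_mem 1 w (h.mem_of_adj hw) (h.mem_of_adj hw')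
  have h01 : ∀ x x' y, X.Adj x y → X.Adj x' y → collapse v x = collapse v x' → x = x' := by
    intro x x' y hx hx' he
    rcases h.collapse_eq_iff.1 he with he | ⟨rfl, rfl⟩ | ⟨rfl, rfl⟩ | ⟨rfl, rfl⟩ | ⟨rfl, rfl⟩
    · exact he
    · exact absurd hx (h4 _ hx')
    · exact absurd hx' (h4 _ hx)
    · exact absurd hx' (h1 _ hx)
    · exact absurd hx (h1 _ hx')
  have hmem : ∀ x y, collapse v x = collapse v y → x ≠ y → ∃ i, x = v i := by
    intro x y he hne
    rcases h.collapse_eq_iff.1 he with he | ⟨rfl, -⟩ | ⟨rfl, -⟩ | ⟨rfl, -⟩ | ⟨rfl, -⟩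
    · exact absurd he hne
    all_goals exact ⟨_, rfl⟩
  have key : ∀ x y x' y', X.Adj x y → X.Adj x' y' → collapse v x = collapse v x' →
      collapse v y = collapse v y' → s(x, y) = s(x', y') := by
    intro x y x' y' hxy hxy' hx hy
    by_cases hxx : x = x'
    · subst hxx
      rw [h01 y y' x hxy.symm hxy'.symm hy]
    · by_cases hyy : y = y'
      · subst hyy
        rw [h01 x x' y hxy hxy' hx]
      · obtain ⟨i, rfl⟩ := hmem x x' hx hxx
        obtain ⟨j, rfl⟩ := hmem y y' hy hyy
        exact absurd hxy (h.not_adj i j)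
  rintro ⟨d, hd⟩ ⟨d', hd'⟩ he
  have he := congrArg Subtype.val he
  apply Subtype.ext
  induction d using Sym2.ind with | _ x y => ?_
  induction d' using Sym2.ind with | _ x' y' => ?_
  simp only [edgeMap, Sym2.map_mk, Sym2.eq_iff, Subtype.mk.injEq] at he
  rcases he with he | he
  · exact key _ _ _ _ hd hd' he.1 he.2
  · exact (key _ _ _ _ hd hd'.symm he.1 he.2).trans Sym2.eq_swap

/-- The only new adjacencies between edges of `X` come from the two identifications of vertices. -/
theorem exists_mem_of_mem_edgeMap (h : IsPentagonRemoval G X v ε) {d d' : X.edgeSet}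
    {z : {x : V // x ∉ s(v 0, v 1)}} (hz : z ∈ (h.edgeMap d).1) (hz' : z ∈ (h.edgeMap d').1) :
    (∃ x, x ∈ d.1 ∧ x ∈ d'.1) ∨ (d = ε 0 ∧ d' = ε 4) ∨ (d = ε 4 ∧ d' = ε 0) ∨
      (d = ε 1 ∧ d' = ε 2) ∨ (d = ε 2 ∧ d' = ε 1) := by
  obtain ⟨x, hx, rx⟩ := h.mem_edgeMap_iff.1 hz
  obtain ⟨y, hy, ry⟩ := h.mem_edgeMap_iff.1 hz'
  simp only [← h.mem_iff]
  rcases h.collapse_eq_iff.1 (rx.trans ry.symm) with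
    rfl | ⟨rfl, rfl⟩ | ⟨rfl, rfl⟩ | ⟨rfl, rfl⟩ | ⟨rfl, rfl⟩
  · exact Or.inl ⟨x, hx, hy⟩
  all_goals tauto

theorem notMem_two (h : IsPentagonRemoval G X v ε) : v 2 ∉ s(v 0, v 1) := by
  simp only [Sym2.mem_iff, h.injective.eq_iff]; decide

theorem notMem_three (h : IsPentagonRemoval G X v ε) : v 3 ∉ s(v 0, v 1) := by
  simp only [Sym2.mem_iff, h.injective.eq_iff]; decide

theorem notMem_four (h : IsPentagonRemoval G X v ε) : v 4 ∉ s(v 0, v 1) := by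
  simp only [Sym2.mem_iff, h.injective.eq_iff]; decide

theorem mem_edgeMap_two (h : IsPentagonRemoval G X v ε) (d : X.edgeSet) :
    ⟨v 2, h.notMem_two⟩ ∈ (h.edgeMap d).1 ↔ d = ε 1 ∨ d = ε 2 := by
  have hc := fun x => h.collapse_eq_iff (x := x) (y := v 2)
  simp only [collapse_of_notMem h.notMem_two] at hc
  have hv : ∀ i j, v i = v j ↔ i = j := fun i j => h.injective.eq_iff
  have h0 : ((2 : ZMod 5) = 0) = False := eq_false (by decide)
  have h1 : ((2 : ZMod 5) = 1) = False := eq_false (by decide)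
  have h4 : ((2 : ZMod 5) = 4) = False := eq_false (by decide)
  simp only [hv, h0, h1, h4, and_false, and_true, or_false, false_or] at hc
  simp only [h.mem_edgeMap_iff, hc, ← h.mem_iff]
  aesop

theorem mem_edgeMap_three (h : IsPentagonRemoval G X v ε) (d : X.edgeSet) :
    ⟨v 3, h.notMem_three⟩ ∈ (h.edgeMap d).1 ↔ d = ε 3 := by
  have hc := fun x => h.collapse_eq_iff (x := x) (y := v 3)
  simp only [collapse_of_notMem h.notMem_three] at hc
  have hv : ∀ i j, v i = v j ↔ i = j := fun i j => h.injective.eq_iff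
  have h0 : ((3 : ZMod 5) = 0) = False := eq_false (by decide)
  have h1 : ((3 : ZMod 5) = 1) = False := eq_false (by decide)
  have h2 : ((3 : ZMod 5) = 2) = False := eq_false (by decide)
  have h4 : ((3 : ZMod 5) = 4) = False := eq_false (by decide)
  simp only [hv, h0, h1, h2, h4, and_false, or_false] at hc
  simp only [h.mem_edgeMap_iff, hc, ← h.mem_iff]
  aesop

theorem mem_edgeMap_four (h : IsPentagonRemoval G X v ε) (d : X.edgeSet) :
    ⟨v 4, h.notMem_four⟩ ∈ (h.edgeMap d).1 ↔ d = ε 0 ∨ d = ε 4 := by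
  have hc := fun x => h.collapse_eq_iff (x := x) (y := v 4)
  simp only [collapse_of_notMem h.notMem_four] at hc
  have hv : ∀ i j, v i = v j ↔ i = j := fun i j => h.injective.eq_iff
  have h0 : ((4 : ZMod 5) = 0) = False := eq_false (by decide)
  have h1 : ((4 : ZMod 5) = 1) = False := eq_false (by decide)
  have h2 : ((4 : ZMod 5) = 2) = False := eq_false (by decide)
  simp only [hv, h0, h1, h2, and_false, and_true, or_false] at hc
  simp only [h.mem_edgeMap_iff, hc, ← h.mem_iff]
  aesop

/-- The edge `(v 2, v 3)` of the reduction. -/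
def edgeTwo (h : IsPentagonRemoval G X v ε) : (edgeReduction G s(v 0, v 1)).edgeSet :=
  ⟨s(⟨v 2, h.notMem_two⟩, ⟨v 3, h.notMem_three⟩),
    fun he => h.injective.ne (show (2 : ZMod 5) ≠ 3 by decide) (congrArg Subtype.val he),
    Or.inl (h.adj_succ 2)⟩

/-- The edge `(v 3, v 4)` of the reduction. -/
def edgeThree (h : IsPentagonRemoval G X v ε) : (edgeReduction G s(v 0, v 1)).edgeSet :=
  ⟨s(⟨v 3, h.notMem_three⟩, ⟨v 4, h.notMem_four⟩),
    fun he => h.injective.ne (show (3 : ZMod 5) ≠ 4 by decide) (congrArg Subtype.val he),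
    Or.inl (h.adj_succ 3)⟩

/-- The two inserted edges are the images of `ε 0` and `ε 1`; of the pentagon, only the two edges
avoiding `v 0` and `v 1` survive. -/
theorem eq_edgeMap_or (h : IsPentagonRemoval G X v ε)
    (d : (edgeReduction G s(v 0, v 1)).edgeSet) :
    (∃ d₀, h.edgeMap d₀ = d) ∨ d = h.edgeTwo ∨ d = h.edgeThree := by
  have hbd : ∀ {x y : {x : V // x ∉ s(v 0, v 1)}} (hxy : X.Adj x.1 y.1),
      (h.edgeMap ⟨s(x.1, y.1), hxy⟩).1 = s(x, y) := fun {x y} hxy => by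
    simp only [edgeMap, Sym2.map_mk, collapse_of_notMem x.2, collapse_of_notMem y.2]
  have hG : ∀ {i : ZMod 5} {x : V}, G.Adj (v i) x → X.Adj (v i) x ∨ x = v (i + 1) ∨
      x = v (i - 1) := fun {i x} hx => by
    rcases (h.adj_iff _ _).1 hx with hx | ⟨j, hj⟩
    · exact Or.inl hx
    · right
      rcases Sym2.eq_iff.1 hj with ⟨hi, rfl⟩ | ⟨hi, rfl⟩
      · left; rw [h.injective hi]
      · right; rw [h.injective hi, add_sub_cancel_right]
  have huniq : ∀ {i : ZMod 5} {x y : V}, X.Adj (v i) x → X.Adj (v i) y → x = y :=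
    fun {i x y} hx hy => Sym2.congr_right.1 (congrArg Subtype.val
      ((h.eq_of_adj hx).symm.trans (h.eq_of_adj hy)))
  have h04 : ∀ x y : {x : V // x ∉ s(v 0, v 1)}, X.Adj (v 0) x.1 → y.1 = v 4 →
      (h.edgeMap (ε 0)).1 = s(x, y) := by
    intro x y hx hy
    refine (congrArg (fun d => (h.edgeMap d).1) (h.eq_of_adj hx)).trans
      (Sym2.eq_iff.2 (Or.inr ⟨Subtype.ext ?_, Subtype.ext (collapse_of_notMem x.2)⟩))
    exact (collapse_zero v).trans hy.symm
  have h12 : ∀ x y : {x : V // x ∉ s(v 0, v 1)}, X.Adj (v 1) x.1 → y.1 = v 2 →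
      (h.edgeMap (ε 1)).1 = s(x, y) := by
    intro x y hx hy
    refine (congrArg (fun d => (h.edgeMap d).1) (h.eq_of_adj hx)).trans
      (Sym2.eq_iff.2 (Or.inr ⟨Subtype.ext ?_, Subtype.ext (collapse_of_notMem x.2)⟩))
    exact (h.collapse_one).trans hy.symm
  obtain ⟨d, hd⟩ := d
  induction d using Sym2.ind with | _ x y => ?_
  obtain ⟨hne, hadj | ⟨p, hp, hpx, hpy⟩⟩ := hd
  · rcases (h.adj_iff _ _).1 hadj with hX | ⟨i, hi⟩
    · exact Or.inl ⟨_, Subtype.ext (hbd hX)⟩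
    · have hx := x.2
      have hy := y.2
      have hcases : ∀ i : ZMod 5, i = 2 ∨ i = 3 ∨ i = 0 ∨ i = 1 ∨ i = 4 := by decide
      right
      rw [Sym2.mem_iff, not_or] at hx hy
      rcases hcases i with rfl | rfl | rfl | rfl | rfl
      · left
        rcases Sym2.eq_iff.1 hi with ⟨ex, ey⟩ | ⟨ex, ey⟩
        · exact Subtype.ext (Sym2.eq_iff.2 (Or.inl ⟨Subtype.ext ex, Subtype.ext ey⟩))
        · exact Subtype.ext (Sym2.eq_iff.2 (Or.inr ⟨Subtype.ext ex, Subtype.ext ey⟩))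
      · right
        rcases Sym2.eq_iff.1 hi with ⟨ex, ey⟩ | ⟨ex, ey⟩
        · exact Subtype.ext (Sym2.eq_iff.2 (Or.inl ⟨Subtype.ext ex, Subtype.ext ey⟩))
        · exact Subtype.ext (Sym2.eq_iff.2 (Or.inr ⟨Subtype.ext ex, Subtype.ext ey⟩))
      · rcases Sym2.eq_iff.1 hi with ⟨ex, ey⟩ | ⟨ex, ey⟩
        · exact absurd ex hx.1
        · exact absurd ey hy.1
      · rcases Sym2.eq_iff.1 hi with ⟨ex, ey⟩ | ⟨ex, ey⟩
        · exact absurd ex hx.2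
        · exact absurd ey hy.2
      · rcases Sym2.eq_iff.1 hi with ⟨ex, ey⟩ | ⟨ex, ey⟩
        · exact absurd ey hy.1
        · exact absurd ex hx.1
  · left
    have hx := x.2
    have hy := y.2
    rw [Sym2.mem_iff, not_or] at hx hy
    rcases Sym2.mem_iff.1 hp with rfl | rfl
    · refine ⟨ε 0, Subtype.ext ?_⟩
      rcases hG hpx with h1 | h1 | h1 <;> rcases hG hpy with h2 | h2 | h2
      · exact absurd (Subtype.ext (huniq h1 h2)) hne
      · exact absurd h2 hy.2
      · exact h04 x y h1 h2
      · exact absurd h1 hx.2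
      · exact absurd h1 hx.2
      · exact absurd h1 hx.2
      · exact (h04 y x h2 h1).trans Sym2.eq_swap
      · exact absurd h2 hy.2
      · exact absurd (Subtype.ext (h1.trans h2.symm)) hne
    · refine ⟨ε 1, Subtype.ext ?_⟩
      rcases hG hpx with h1 | h1 | h1 <;> rcases hG hpy with h2 | h2 | h2
      · exact absurd (Subtype.ext (huniq h1 h2)) hne
      · exact h12 x y h1 h2
      · exact absurd h2 hy.1
      · exact (h12 y x h2 h1).trans Sym2.eq_swap
      · exact absurd (Subtype.ext (h1.trans h2.symm)) hne
      · exact absurd h2 hy.1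
      · exact absurd h1 hx.1
      · exact absurd h1 hx.1
      · exact absurd h1 hx.1

theorem edgeTwo_ne_edgeThree (h : IsPentagonRemoval G X v ε) : h.edgeTwo ≠ h.edgeThree := by
  intro he
  have h2 : (⟨v 2, h.notMem_two⟩ : {x : V // x ∉ s(v 0, v 1)}) ∈ h.edgeThree.1 :=
    he ▸ Sym2.mem_mk_left _ _
  simp only [edgeThree, Sym2.mem_iff, Subtype.mk.injEq, h.injective.eq_iff] at h2
  revert h2; decide

theorem edgeMap_ne_edgeTwo (h : IsPentagonRemoval G X v ε) (d : X.edgeSet) :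
    h.edgeMap d ≠ h.edgeTwo := by
  intro he
  have h2 := (h.mem_edgeMap_two d).1 (he ▸ Sym2.mem_mk_left _ _)
  have h3 := (h.mem_edgeMap_three d).1 (he ▸ Sym2.mem_mk_right _ _)
  rw [h3, h.edge_injective.eq_iff, h.edge_injective.eq_iff] at h2
  revert h2; decide

theorem edgeMap_ne_edgeThree (h : IsPentagonRemoval G X v ε) (d : X.edgeSet) :
    h.edgeMap d ≠ h.edgeThree := by
  intro he
  have h2 := (h.mem_edgeMap_four d).1 (he ▸ Sym2.mem_mk_right _ _)
  have h3 := (h.mem_edgeMap_three d).1 (he ▸ Sym2.mem_mk_left _ _)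
  rw [h3, h.edge_injective.eq_iff, h.edge_injective.eq_iff] at h2
  revert h2; decide

theorem eq_neg_sub_of_ne : ∀ {a b k : ZMod 3}, a ≠ b → k ≠ a → k ≠ b → k = - a - b := by
  decide

theorem neg_sub_ne_of_ne : ∀ {a b : ZMod 3}, a ≠ b → - a - b ≠ a ∧ - a - b ≠ b := by
  decide

theorem edgeColorings.ne_of_mem {W : Type*} {H : SimpleGraph W} {c : H.edgeSet → ZMod 3}
    (hc : c ∈ edgeColorings H) {d d' : H.edgeSet} (z : W) (hz : z ∈ d.1) (hz' : z ∈ d'.1)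
    (hne : d ≠ d') : c d ≠ c d' := fun he => hne (hc d d' z hz hz' he)

/-- The colours which a colouring of the reduction gives to the edges of `X` and to the two
remaining edges. -/
theorem colors_of_mem (h : IsPentagonRemoval G X v ε)
    {c : (edgeReduction G s(v 0, v 1)).edgeSet → ZMod 3}
    (hc : c ∈ edgeColorings (edgeReduction G s(v 0, v 1))) :
    c ∘ h.edgeMap ∈ edgeColorings X ∧
      c (h.edgeMap (ε 1)) ≠ c (h.edgeMap (ε 2)) ∧ c (h.edgeMap (ε 0)) ≠ c (h.edgeMap (ε 4)) ∧
      c h.edgeTwo = - c (h.edgeMap (ε 1)) - c (h.edgeMap (ε 2)) ∧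
      c h.edgeThree = - c (h.edgeMap (ε 0)) - c (h.edgeMap (ε 4)) ∧
      c h.edgeTwo ≠ c (h.edgeMap (ε 3)) ∧ c h.edgeThree ≠ c (h.edgeMap (ε 3)) ∧
      c h.edgeTwo ≠ c h.edgeThree := by
  have e21 := (h.mem_edgeMap_two (ε 1)).2 (Or.inl rfl)
  have e22 := (h.mem_edgeMap_two (ε 2)).2 (Or.inr rfl)
  have e33 := (h.mem_edgeMap_three (ε 3)).2 rfl
  have e40 := (h.mem_edgeMap_four (ε 0)).2 (Or.inl rfl)
  have e44 := (h.mem_edgeMap_four (ε 4)).2 (Or.inr rfl)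
  have h12 := edgeColorings.ne_of_mem hc _ e21 e22
    (h.edgeMap_injective.ne (h.edge_injective.ne (by decide)))
  have h04 := edgeColorings.ne_of_mem hc _ e40 e44
    (h.edgeMap_injective.ne (h.edge_injective.ne (by decide)))
  have t2 : _ ∈ h.edgeTwo.1 := Sym2.mem_mk_left _ _
  have t3 : _ ∈ h.edgeTwo.1 := Sym2.mem_mk_right _ _
  have t3' : _ ∈ h.edgeThree.1 := Sym2.mem_mk_left _ _
  have t4 : _ ∈ h.edgeThree.1 := Sym2.mem_mk_right _ _
  refine ⟨fun d d' z hz hz' he => h.edgeMap_injective (hc _ _ ⟨collapse v z, h.collapse_notMem z⟩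
    (h.mem_edgeMap_iff.2 ⟨z, hz, rfl⟩) (h.mem_edgeMap_iff.2 ⟨z, hz', rfl⟩) he), h12, h04,
    eq_neg_sub_of_ne h12 ?_ ?_, eq_neg_sub_of_ne h04 ?_ ?_, ?_, ?_, ?_⟩
  · exact edgeColorings.ne_of_mem hc _ t2 e21 (h.edgeMap_ne_edgeTwo _).symm
  · exact edgeColorings.ne_of_mem hc _ t2 e22 (h.edgeMap_ne_edgeTwo _).symm
  · exact edgeColorings.ne_of_mem hc _ t4 e40 (h.edgeMap_ne_edgeThree _).symm
  · exact edgeColorings.ne_of_mem hc _ t4 e44 (h.edgeMap_ne_edgeThree _).symm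
  · exact edgeColorings.ne_of_mem hc _ t3 e33 (h.edgeMap_ne_edgeTwo _).symm
  · exact edgeColorings.ne_of_mem hc _ t3' e33 (h.edgeMap_ne_edgeThree _).symm
  · exact edgeColorings.ne_of_mem hc _ t3 t3' h.edgeTwo_ne_edgeThree

/-- The colourings of `X` which extend to the reduction. -/
theorem exists_edgeColorings_reduction (h : IsPentagonRemoval G X v ε) {c : X.edgeSet → ZMod 3}
    (hc : c ∈ edgeColorings X) (h12 : c (ε 1) ≠ c (ε 2)) (h04 : c (ε 0) ≠ c (ε 4))
    (h3 : - c (ε 1) - c (ε 2) ≠ c (ε 3)) (h3' : - c (ε 0) - c (ε 4) ≠ c (ε 3))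
    (h23 : - c (ε 1) - c (ε 2) ≠ - c (ε 0) - c (ε 4)) :
    ∃ c' ∈ edgeColorings (edgeReduction G s(v 0, v 1)), c' ∘ h.edgeMap = c := by
  classical
  let c' := Function.extend h.edgeMap c
    fun d => if d = h.edgeTwo then - c (ε 1) - c (ε 2) else - c (ε 0) - c (ε 4)
  have hmap : ∀ d, c' (h.edgeMap d) = c d := h.edgeMap_injective.extend_apply _ _
  have htwo : c' h.edgeTwo = - c (ε 1) - c (ε 2) := by
    simp only [c']
    rw [Function.extend_apply' _ _ _ fun ⟨d, hd⟩ => h.edgeMap_ne_edgeTwo d hd, if_pos rfl]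
  have hthree : c' h.edgeThree = - c (ε 0) - c (ε 4) := by
    simp only [c']
    rw [Function.extend_apply' _ _ _ fun ⟨d, hd⟩ => h.edgeMap_ne_edgeThree d hd,
      if_neg h.edgeTwo_ne_edgeThree.symm]
  have hmm : ∀ d d' z, z ∈ (h.edgeMap d).1 → z ∈ (h.edgeMap d').1 → c d = c d' → d = d' := by
    intro d d' z hz hz' he
    rcases h.exists_mem_of_mem_edgeMap hz hz' with
      ⟨x, hx, hx'⟩ | ⟨rfl, rfl⟩ | ⟨rfl, rfl⟩ | ⟨rfl, rfl⟩ | ⟨rfl, rfl⟩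
    · exact hc d d' x hx hx' he
    · exact absurd he h04
    · exact absurd he.symm h04
    · exact absurd he h12
    · exact absurd he.symm h12
  have h2m : ∀ d z, z ∈ (h.edgeMap d).1 → z ∈ h.edgeTwo.1 → - c (ε 1) - c (ε 2) ≠ c d := by
    intro d z hz hz'
    rcases Sym2.mem_iff.1 hz' with rfl | rfl
    · rcases (h.mem_edgeMap_two d).1 hz with rfl | rfl
      · exact (neg_sub_ne_of_ne h12).1
      · exact (neg_sub_ne_of_ne h12).2
    · rw [(h.mem_edgeMap_three d).1 hz]
      exact h3
  have h3m : ∀ d z, z ∈ (h.edgeMap d).1 → z ∈ h.edgeThree.1 → - c (ε 0) - c (ε 4) ≠ c d := by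
    intro d z hz hz'
    rcases Sym2.mem_iff.1 hz' with rfl | rfl
    · rw [(h.mem_edgeMap_three d).1 hz]
      exact h3'
    · rcases (h.mem_edgeMap_four d).1 hz with rfl | rfl
      · exact (neg_sub_ne_of_ne h04).1
      · exact (neg_sub_ne_of_ne h04).2
  refine ⟨c', fun d d' z hz hz' he => ?_, funext hmap⟩
  rcases h.eq_edgeMap_or d with ⟨d, rfl⟩ | rfl | rfl <;>
    rcases h.eq_edgeMap_or d' with ⟨d', rfl⟩ | rfl | rfl
  · rw [hmap, hmap] at he
    rw [hmm d d' z hz hz' he]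
  · rw [hmap, htwo] at he
    exact absurd he.symm (h2m d z hz hz')
  · rw [hmap, hthree] at he
    exact absurd he.symm (h3m d z hz hz')
  · rw [hmap, htwo] at he
    exact absurd he (h2m d' z hz' hz)
  · rfl
  · rw [htwo, hthree] at he
    exact absurd he h23
  · rw [hmap, hthree] at he
    exact absurd he (h3m d' z hz' hz)
  · rw [htwo, hthree] at he
    exact absurd he.symm h23
  · rfl

/-- Restriction to `X` is injective, since the colours of `edgeTwo` and `edgeThree` are forced, and
its image consists of the types 0, 1 and 3. -/
theorem ncard_edgeColorings_reduction [Fintype V] (h : IsPentagonRemoval G X v ε)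
    (hG : ¬ IsEdgeThreeColorable G) :
    (edgeColorings (edgeReduction G s(v 0, v 1))).ncard =
      3 * (IsPentagonComplement.tripleColorings ε 0).ncard := by
  have hX : ∀ c ∈ edgeColorings X, IsObstruction fun j => c (ε j) := fun c hc =>
    h.isObstruction hG hc
  rw [← h.ncard_isTriple_zero_or_one_or_three hX]
  refine Set.ncard_congr (fun c _ => c ∘ h.edgeMap) ?_ ?_ ?_
  · intro c hc
    obtain ⟨hm, h12, h04, e2, e3, h2, h3, h23⟩ := h.colors_of_mem hc
    rw [e2] at h2 h23
    rw [e3] at h3 h23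
    exact ⟨hm, (hX _ hm).isTriple_zero_or_one_or_three_iff.2 ⟨h12, h04, h2, h3, h23⟩⟩
  · intro c c' hc hc' he
    obtain ⟨-, -, -, e2, e3, -⟩ := h.colors_of_mem hc
    obtain ⟨-, -, -, e2', e3', -⟩ := h.colors_of_mem hc'
    have he : ∀ d, c (h.edgeMap d) = c' (h.edgeMap d) := congrFun he
    funext d
    rcases h.eq_edgeMap_or d with ⟨d, rfl⟩ | rfl | rfl
    · exact he d
    · rw [e2, e2', he, he]
    · rw [e3, e3', he, he]
  · rintro c ⟨hc, ht⟩
    obtain ⟨h12, h04, h3, h3', h23⟩ := (hX _ hc).isTriple_zero_or_one_or_three_iff.1 ht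
    obtain ⟨c', hc', he⟩ := h.exists_edgeColorings_reduction hc h12 h04 h3 h3' h23
    exact ⟨c', hc', he⟩

theorem psi_eq [Fintype V] (h : IsPentagonRemoval G X v ε) (hG : ¬ IsEdgeThreeColorable G) :
    6 * psi G s(v 0, v 1) = (IsPentagonComplement.tripleColorings ε 0).ncard := by
  -- All three colours already occur on the images of the five edges leaving the pentagon.
  have h6 := ncard_edgeColorings_eq (G := edgeReduction G s(v 0, v 1)) (fun c hc => by
    have := (h.isObstruction hG (h.colors_of_mem hc).1).surjective
    exact fun k => (this k).imp' (fun i => h.edgeMap (ε i)) fun _ hi => hi) fun _ => True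
  simp only [and_true, Set.ofPred_mem_eq] at h6
  rw [h.ncard_edgeColorings_reduction hG] at h6
  have : (3 * (IsPentagonComplement.tripleColorings ε 0).ncard : ℚ) =
      6 * (ED (edgeReduction G s(v 0, v 1))).ncard := by exact_mod_cast h6
  rw [psi]
  linarith

end Reduction

theorem ncard_ED [Fintype V] (h : IsPentagonRemoval G X v ε) (hG : ¬ IsEdgeThreeColorable G) :
    6 * (ED X).ncard = 5 * (IsPentagonComplement.tripleColorings ε 0).ncard := by
  have hX : ∀ c ∈ edgeColorings X, IsObstruction fun j => c (ε j) := fun c hc =>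
    h.isObstruction hG hc
  have h6 := ncard_edgeColorings_eq (G := X) (fun c hc k =>
    ((hX c hc).surjective k).imp' ε fun _ hi => hi) fun _ => True
  simp only [and_true, Set.ofPred_mem_eq] at h6
  rw [← h6, h.ncard_edgeColorings_eq_five hX]

theorem ncard_ED_triple [Fintype V] (h : IsPentagonRemoval G X v ε)
    (hG : ¬ IsEdgeThreeColorable G) (i : ZMod 5) :
    6 * {δ ∈ ED X | δ (ε (i - 2)) (ε i) ∧ δ (ε i) (ε (i + 2))}.ncard =
      (IsPentagonComplement.tripleColorings ε 0).ncard := by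
  have hX : ∀ c ∈ edgeColorings X, IsObstruction fun j => c (ε j) := fun c hc =>
    h.isObstruction hG hc
  rw [← ncard_edgeColorings_eq (G := X) (fun c hc k =>
    ((hX c hc).surjective k).imp' ε fun _ hi => hi), ← h.ncard_tripleColorings_eq hX i]
  rfl

end IsPentagonRemoval

/-! ### Pentagons in cubic graphs of girth at least five -/

variable {V : Type*} {G : SimpleGraph V}

theorem IsPentagonWith.adj_iff {P : G.Subgraph} {v : ZMod 5 → V} (hP : IsPentagonWith P v)
    (i : ZMod 5) (y : V) : P.Adj (v i) y ↔ y = v (i + 1) ∨ y = v (i - 1) := by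
  rw [← SimpleGraph.Subgraph.mem_edgeSet, hP.edgeSet_eq]
  constructor
  · rintro ⟨j, hj⟩
    rcases Sym2.eq_iff.1 hj with ⟨hi, rfl⟩ | ⟨rfl, hi⟩
    · rw [hP.injective hi]; exact Or.inl rfl
    · right; rw [← hP.injective hi, add_sub_cancel_right]
  · rintro (rfl | rfl)
    · exact ⟨i, rfl⟩
    · refine ⟨i - 1, ?_⟩
      simp only [sub_add_cancel]
      exact Sym2.eq_swap

/-- Rotating the labels lets any edge of the pentagon play the role of `(v 0, v 1)`. -/
theorem IsPentagonWith.shift {P : G.Subgraph} {v : ZMod 5 → V} (hP : IsPentagonWith P v)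
    (j : ZMod 5) : IsPentagonWith P fun i => v (i + j) where
  injective := hP.injective.comp (add_left_injective j)
  verts_eq := hP.verts_eq.trans ((Equiv.addRight j).surjective.range_comp v).symm
  edgeSet_eq := by
    rw [hP.edgeSet_eq, ← (Equiv.addRight j).surjective.range_comp]
    simp only [Function.comp_def, Equiv.coe_addRight, add_right_comm]

theorem IsPentagonWith.ncard_neighborSet {P : G.Subgraph} {v : ZMod 5 → V}
    (hP : IsPentagonWith P v) (i : ZMod 5) : (P.neighborSet (v i)).ncard = 2 := by
  have : P.neighborSet (v i) = {v (i + 1), v (i - 1)} := by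
    ext y
    exact hP.adj_iff i y
  rw [this, Set.ncard_pair (hP.injective.ne (by
    have : ∀ i : ZMod 5, i + 1 ≠ i - 1 := by decide
    exact this i))]

/-- A graph of girth at least five has no triangles. -/
theorem not_adj_of_five_le_egirth (hg : 5 ≤ G.egirth) {x y z : V} (hxy : G.Adj x y)
    (hyz : G.Adj y z) : ¬ G.Adj z x := fun hzx => by
  have hc : (SimpleGraph.Walk.cons hxy (.cons hyz (.cons hzx .nil))).IsCycle := by
    have h1 := hxy.ne
    have h2 := hyz.ne
    have h3 := hzx.ne
    simp only [SimpleGraph.Walk.isCycle_def, SimpleGraph.Walk.isTrail_def]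
    simp
    grind
  have := SimpleGraph.le_egirth.1 hg _ _ hc
  simp only [SimpleGraph.Walk.length_cons, SimpleGraph.Walk.length_nil] at this
  exact absurd this (by decide)

/-- The girth enters through triangles: a chord would join vertices at distance two on the pentagon,
and outer edges at consecutive vertices with a common end would close a triangle. -/
theorem IsPentagonWith.exists_isPentagonRemoval [Finite V] (hcub : ∀ x, (G.neighborSet x).ncard = 3)
    (hev : Even (Nat.card V)) (hg : 5 ≤ G.egirth) {P : G.Subgraph} {v : ZMod 5 → V}
    (hP : IsPentagonWith P v) :
    ∃ ε, IsPentagonRemoval G (G.deleteEdges P.edgeSet) v ε := by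
  have hX : ∀ x y, (G.deleteEdges P.edgeSet).Adj x y ↔ G.Adj x y ∧ ¬ P.Adj x y := fun x y => by
    rw [SimpleGraph.deleteEdges_adj, SimpleGraph.Subgraph.mem_edgeSet]
  have hun : ∀ i, ∃ w, (G.deleteEdges P.edgeSet).neighborSet (v i) = {w} := fun i => by
    rw [← Set.ncard_eq_one]
    have : (G.deleteEdges P.edgeSet).neighborSet (v i) =
        G.neighborSet (v i) \ P.neighborSet (v i) := by
      ext y
      exact hX _ _
    rw [this, Set.ncard_sdiff (P.neighborSet_subset _), hcub, hP.ncard_neighborSet]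
  choose w hw using hun
  have hw' : ∀ i y, (G.deleteEdges P.edgeSet).Adj (v i) y ↔ y = w i := fun i y => by
    rw [← SimpleGraph.mem_neighborSet, hw, Set.mem_singleton_iff]
  have hadj : ∀ i, G.Adj (v i) (v (i + 1)) := fun i =>
    ((hP.adj_iff i _).2 (Or.inl rfl)).adj_sub
  have hwv : ∀ i j, v j ≠ w i := by
    intro i j he
    have hij := (hw' i (v j)).2 he
    rw [hX, hP.adj_iff, not_or] at hij
    obtain ⟨hij, h1, h2⟩ := hij
    have hc : ∀ i j : ZMod 5, j = i ∨ j = i + 1 ∨ j = i - 1 ∨ j = i + 1 + 1 ∨ i = j + 1 + 1 := by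
      decide
    rcases hc i j with rfl | rfl | rfl | rfl | rfl
    · exact hij.ne rfl
    · exact h1 rfl
    · exact h2 rfl
    · exact not_adj_of_five_le_egirth hg (hadj i) (hadj (i + 1)) hij.symm
    · exact not_adj_of_five_le_egirth hg (hadj j) (hadj (j + 1)) hij
  have hvw : ∀ i, (G.deleteEdges P.edgeSet).Adj (v i) (w i) := fun i => (hw' i _).2 rfl
  refine ⟨fun i => ⟨s(v i, w i), hvw i⟩, ⟨⟨?_, ?_, ?_, hev⟩, ?_, ?_⟩⟩
  · intro i d
    constructor
    · intro hd
      obtain ⟨y, hy⟩ := Sym2.mem_iff_exists.1 hd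
      have hd' : s(v i, y) ∈ (G.deleteEdges P.edgeSet).edgeSet := hy ▸ d.2
      exact Subtype.ext (by rw [hy, (hw' i y).1 hd'])
    · rintro rfl
      exact Sym2.mem_mk_left _ _
  · intro i j hj
    rcases Sym2.mem_iff.1 hj with hj | hj
    · exact hP.injective hj
    · exact absurd hj (hwv i j)
  · intro y hy
    rw [← hcub y]
    congr 1
    ext z
    rw [SimpleGraph.mem_neighborSet, hX, SimpleGraph.mem_neighborSet, and_iff_left_iff_imp]
    exact fun _ hyz => hy (hP.verts_eq ▸ hyz.fst_mem)
  · intro x y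
    rw [hX]
    have : P.Adj x y ↔ ∃ i, s(x, y) = s(v i, v (i + 1)) := by
      rw [← SimpleGraph.Subgraph.mem_edgeSet, hP.edgeSet_eq, Set.mem_range]
      simp only [eq_comm]
    rw [← this]
    by_cases hp : P.Adj x y
    · simp only [hp, hp.adj_sub, not_true, and_false, or_true]
    · simp only [hp, not_false_eq_true, and_true, or_false]
  · intro i x hx hx'
    have hx : x = v i ∨ x = w i := Sym2.mem_iff.1 hx
    have hx' : x = v (i + 1) ∨ x = w (i + 1) := Sym2.mem_iff.1 hx'
    rcases hx with rfl | rfl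
    · rcases hx' with hx' | hx'
      · exact (hadj i).ne hx'
      · exact hwv _ _ hx'
    · rcases hx' with hx' | hx'
      · exact hwv _ _ hx'.symm
      · have h1 := ((hX _ _).1 (hvw i)).1
        have h2 := ((hX _ _).1 (hvw (i + 1))).1
        rw [← hx'] at h2
        exact not_adj_of_five_le_egirth hg (hadj i) h2 h1.symm

/-- The count of colourings of one type refers to the rotated labelling adapted to `e`; eliminating
it leaves a quantity that depends on `P` alone. -/
theorem IsPentagonWith.five_mul_psi_eq [Fintype V] (hcub : ∀ x, (G.neighborSet x).ncard = 3)
    (hev : Even (Nat.card V)) (hg : 5 ≤ G.egirth) (hcol : ¬ IsEdgeThreeColorable G)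
    {P : G.Subgraph} {v : ZMod 5 → V} (hP : IsPentagonWith P v)
    {e : Sym2 V} (he : e ∈ P.edgeSet) :
    5 * psi G e = (ED (G.deleteEdges P.edgeSet)).ncard := by
  rw [hP.edgeSet_eq] at he
  obtain ⟨j, rfl⟩ := he
  obtain ⟨ε, h⟩ := (hP.shift j).exists_isPentagonRemoval hcub hev hg
  have h1 := h.psi_eq hcol
  have h2 : (6 * (ED (G.deleteEdges P.edgeSet)).ncard : ℚ) =
    5 * (IsPentagonComplement.tripleColorings ε 0).ncard := by exact_mod_cast h.ncard_ED hcol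
  rw [zero_add, add_comm 1 j] at h1
  linarith

/-- In a cubic graph, two pentagons with a common vertex have a common edge at this vertex. -/
theorem exists_adj_adj [Finite V] (hcub : ∀ x, (G.neighborSet x).ncard = 3) {P Q : G.Subgraph}
    (hP : IsPentagon P) (hQ : IsPentagon Q) {x : V} (hxP : x ∈ P.verts) (hxQ : x ∈ Q.verts) :
    ∃ y, P.Adj x y ∧ Q.Adj x y := by
  obtain ⟨v, hv⟩ := hP
  obtain ⟨u, hu⟩ := hQ
  have h1 : (P.neighborSet x).ncard = 2 := by
    obtain ⟨i, rfl⟩ := hv.verts_eq ▸ hxP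
    exact hv.ncard_neighborSet i
  have h2 : (Q.neighborSet x).ncard = 2 := by
    obtain ⟨i, rfl⟩ := hu.verts_eq ▸ hxQ
    exact hu.ncard_neighborSet i
  by_contra hne
  have hd : Disjoint (P.neighborSet x) (Q.neighborSet x) :=
    Set.disjoint_left.2 fun y hy hy' => hne ⟨y, hy, hy'⟩
  have h3 := Set.ncard_union_eq hd
  -- Two disjoint pairs of neighbours do not fit among three.
  have h4 := Set.ncard_le_ncard
    (Set.union_subset (P.neighborSet_subset x) (Q.neighborSet_subset x))
  rw [hcub] at h4
  omega

end SnarkPentagon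

/-! ### Proof of the theorem -/

open SnarkPentagon

theorem theorem4p5 {V : Type*} [Fintype V] (G : SimpleGraph V) [DecidableRel G.Adj]
    (hG : SnarkPentagon.IsSnark G) :
    -- (A)
    (∀ F : Set G.Subgraph, (∀ P ∈ F, SnarkPentagon.IsPentagon P) →
      ∀ H : G.Subgraph, H = sSup F → H.Connected →
        ∀ e ∈ H.edgeSet, ∀ f ∈ H.edgeSet, SnarkPentagon.psi G e = SnarkPentagon.psi G f) ∧
    -- (B)
    (∀ (P : G.Subgraph) (v : ZMod 5 → V), SnarkPentagon.IsPentagonWith P v →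
      -- `ε i` is the unique edge of `G - E(P)` at the vertex `v i`
      ∃ ε : ZMod 5 → (G.deleteEdges P.edgeSet).edgeSet,
        (∀ (i : ZMod 5) (d : (G.deleteEdges P.edgeSet).edgeSet),
          v i ∈ (d : Sym2 V) ↔ d = ε i) ∧
        ∀ e ∈ P.edgeSet,
          ((SnarkPentagon.ED (G.deleteEdges P.edgeSet)).ncard : ℚ)
              = 5 * SnarkPentagon.psi G e ∧
          ∀ i : ZMod 5,
            (({δ ∈ SnarkPentagon.ED (G.deleteEdges P.edgeSet) |
                δ (ε (i - 2)) (ε i) ∧ δ (ε i) (ε (i + 2))}.ncard : ℕ) : ℚ)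
              = SnarkPentagon.psi G e) := by
  have hcub : ∀ x, (G.neighborSet x).ncard = 3 := fun x => by
    rw [← Nat.card_coe_set_eq, Nat.card_eq_fintype_card, SimpleGraph.card_neighborSet_eq_degree]
    exact hG.cubic x
  -- Handshake lemma: every vertex has odd degree.
  have hev : Even (Nat.card V) := by
    have h := G.even_card_odd_degree_vertices
    rw [Finset.filter_true_of_mem fun x _ => by rw [hG.cubic x]; decide, Finset.card_univ] at h
    rwa [Nat.card_eq_fintype_card]
  have hpsi : ∀ {P : G.Subgraph} {v : ZMod 5 → V}, IsPentagonWith P v → ∀ {e}, e ∈ P.edgeSet →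
      5 * psi G e = (ED (G.deleteEdges P.edgeSet)).ncard := fun hP _ he =>
    hP.five_mul_psi_eq hcub hev hG.girth hG.not_colorable he
  refine ⟨?_, fun P v hP => ?_⟩
  · rintro F hF H rfl hH e he f hf
    have hsame : ∀ P ∈ F, ∀ e ∈ P.edgeSet, ∀ f ∈ P.edgeSet, psi G e = psi G f := by
      intro P hP e he f hf
      obtain ⟨v, hv⟩ := hF P hP
      have h1 := hpsi hv he
      have h2 := hpsi hv hf
      linarith
    have hlocal : ∀ x y z, (sSup F).Adj x y → (sSup F).Adj x z → psi G s(x, y) = psi G s(x, z) := by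
      intro x y z hy hz
      obtain ⟨P, hP, hPy⟩ := SimpleGraph.Subgraph.sSup_adj.1 hy
      obtain ⟨Q, hQ, hQz⟩ := SimpleGraph.Subgraph.sSup_adj.1 hz
      obtain ⟨t, ht, ht'⟩ := exists_adj_adj hcub (hF P hP) (hF Q hQ) hPy.fst_mem hQz.fst_mem
      exact (hsame P hP s(x, y) hPy s(x, t) ht).trans (hsame Q hQ s(x, t) ht' s(x, z) hQz)
    -- Quantifying over all edges at both ends lets the induction pass through the walk edge shared
    -- by consecutive vertices.
    have hwalk : ∀ (a b : (sSup F).verts), (sSup F).coe.Walk a b → ∀ y z, (sSup F).Adj a y →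
        (sSup F).Adj b z → psi G s(a.1, y) = psi G s(b.1, z) := by
      intro a b p
      induction p with
      | nil => exact fun y z hy hz => hlocal _ y z hy hz
      | @cons a c b hac _ ih =>
        intro y z hy hz
        have hac : (sSup F).Adj a c := hac
        rw [hlocal _ y c hy hac, Sym2.eq_swap]
        exact ih a z hac.symm hz
    induction e using Sym2.ind with | _ a y => ?_
    induction f using Sym2.ind with | _ b z => ?_
    have he : (sSup F).Adj a y := he
    have hf : (sSup F).Adj b z := hf
    obtain ⟨p⟩ := hH.preconnected ⟨a, he.fst_mem⟩ ⟨b, hf.fst_mem⟩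
    exact hwalk _ _ p y z he hf
  · obtain ⟨ε, h⟩ := hP.exists_isPentagonRemoval hcub hev hG.girth
    refine ⟨ε, h.mem_iff, fun e he => ⟨(hpsi hP he).symm, fun i => ?_⟩⟩
    have h1 := hpsi hP he
    have h2 : (6 * (ED (G.deleteEdges P.edgeSet)).ncard : ℚ) =
      5 * (IsPentagonComplement.tripleColorings ε 0).ncard := by
        exact_mod_cast h.ncard_ED hG.not_colorable
    have h3 : (6 * {δ ∈ ED (G.deleteEdges P.edgeSet) |
          δ (ε (i - 2)) (ε i) ∧ δ (ε i) (ε (i + 2))}.ncard : ℚ) =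
        (IsPentagonComplement.tripleColorings ε 0).ncard := by
      exact_mod_cast h.ncard_ED_triple hG.not_colorable i
    linarith
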